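/- Logarithms are in base $2$, $\log 0=-\infty$, and $h(p)=-p\log p-(1-p)\log(1-p)$. Tensors are over $\mathbb{C}$, $\mathrm{R}$ denotes tensor rank and $\boxtimes$ the Kronecker product; the exponent of a tensor $T$ is $\omega(T)=\log\lim_{N\to\infty}\mathrm{R}(T^{\boxtimes N})^{1/N}$. The graph tensor of a graph with vertices $0,\dots,d$ and edge weights $m_I\in\mathbb{N}$ is $T(G,m)=\boxtimes_{I}\mathbf{u}_{(I)}(m_I)$, where $\mathbf{u}_{(I)}(m)=\bigl[\sum_{j=1}^{m}\bigotimes_{i\in I}e_j^{(i)}\bigr]\otimes\bigotimes_{i\notin I}e_0^{(i)}$ with $e^{(i)}_1,\dots,e^{(i)}_m$ a basis of $\mathbb{C}^m$ and $e_0^{(i)}$ a basis of $\mathbb{C}^1$. For $d\ge 3$, $\mathbf{multiEMaMu}(d;a,b)$ is the graph tensor of the graph on $0,\dots,d$ with the edges $\{i,d\}$, $0\le i\le d-1$, each of weight $a$, and the edge $\{0,1\}$ of weight $b$. For real weights $a,b\ge 0$ put $$\omega(\mathbf{multiEMaMu}(d;a,b))=\log\lim_{N\to\infty}\mathrm{R}\bigl(\mathbf{multiEMaMu}(d;\lceil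 a^N\rceil,\lceil b^N\rceil)\bigr)^{1/N},$$ which for integers $a,b$ is the exponent of the tensor $\mathbf{multiEMaMu}(d;a,b)$, because $\mathbf{multiEMaMu}(d;a,b)^{\boxtimes N}=\mathbf{multiEMaMu}(d;a^N,b^N)$. **Theorem.** Let $n\ge 0$ and $d\ge 3$ be integers and let $p\in(0,1)$ be real. Then the limits in question exist, and $$\omega\bigl(\mathbf{multiEMaMu}(d;n,n^{d\frac{1-p}{p}})\bigr)\le B:=\frac1p\Bigl[\log\bigl(n^d+2n^{d-1}+n^2(n+1)^{d-3}+1\bigr)-h(p)\Bigr].$$ Moreover, for every integer $K\ge 1$ for which $M=n^{Kd\frac{1-p}{p}}$ is an integer, the tensor $\mathbf{multiEMaMu}(d;n^K,M)$, the $K$-th Kronecker power of $\mathbf{multiEMaMu}(d;n,n^{d\frac{1-p}{p}})$, satisfies $$\omega\bigl(\mathbf{multiEMaMu}(d;n^K,M)\bigr)\le K\,B .$$ -/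

import Mathlib

open Filter Topology

/-- A complex tensor in coordinates, of order the number of elements of `V`: an element of
`⨂_{v ∈ V} ℂ^{ι v}`, given by its coefficients in the basis of tensor products of standard
basis vectors. The finite set `V` labels the factors, `ι v` labels the basis of factor `v`. -/
abbrev CoordTensor {V : Type} (ι : V → Type) : Type := (∀ v, ι v) → ℂ

/-- The simple tensor `⨂_v x v`. -/
def simpleTensor {V : Type} [Fintype V] {ι : V → Type} (x : ∀ v, ι v → ℂ) : CoordTensor ι :=
  fun i => ∏ v, x v (i v)

/-- Tensor rank: the least number of simple tensors with sum `T`. -/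
noncomputable def tensorRank {V : Type} [Fintype V] {ι : V → Type} (T : CoordTensor ι) : ℕ :=
  sInf {r : ℕ | ∃ x : Fin r → ∀ v, ι v → ℂ, T = ∑ a, simpleTensor (x a)}

/-- The Kronecker product of a finite family of tensors with the same set `V` of factors:
factor `v` of the product is the tensor product of the factors `v` of the members. -/
def kroneckerProd {V E : Type} [Fintype E] {ι : E → V → Type}
    (T : ∀ e, CoordTensor (ι e)) : CoordTensor (fun v => ∀ e, ι e v) :=
  fun i => ∏ e, T e (fun v => i v e)

/-- The Kronecker power `T^{⊠ N}`. -/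
def kroneckerPow {V : Type} {ι : V → Type} (T : CoordTensor ι) (N : ℕ) :
    CoordTensor (fun v => Fin N → ι v) :=
  kroneckerProd (fun _ : Fin N => T)

/-- The tensor `u_(I)(m) = [∑_{j < m} ⨂_{v ∈ I} e_j] ⊗ [⨂_{v ∉ I} e_0]` of a hyperedge `I` of
weight `m`; its factor `v` is `ℂ^m` if `v ∈ I` and `ℂ^1` otherwise. -/
def edgeTensor {V : Type} [Fintype V] [DecidableEq V] (I : Finset V) (m : ℕ) :
    CoordTensor (fun v => Fin (if v ∈ I then m else 1)) :=
  ∑ j : Fin m, simpleTensor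
    (fun v (x : Fin (if v ∈ I then m else 1)) => if v ∈ I then (if (x : ℕ) = j then 1 else 0) else 1)

/-- The graph tensor of the hypergraph with vertex set `V` and hyperedges `inc e`, `e : E`,
with weights `m`. -/
def graphTensor {V E : Type} [Fintype V] [DecidableEq V] [Fintype E]
    (inc : E → Finset V) (m : E → ℕ) :
    CoordTensor (fun v => ∀ e, Fin (if v ∈ inc e then m e else 1)) :=
  kroneckerProd (fun e => edgeTensor (inc e) (m e))

/-- Logarithm in base `2` of a nonnegative real number, with `log 0 = -∞`. -/
noncomputable def logTwo (x : ℝ) : EReal := if x = 0 then ⊥ else (Real.logb 2 x : EReal)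

/-- `T` has asymptotic rank `ρ`: the numbers `R(T^{⊠ N})^{1/N}` converge to `ρ`. -/
def HasAsymptoticRank {V : Type} [Fintype V] {ι : V → Type} (T : CoordTensor ι) (ρ : ℝ) : Prop :=
  Tendsto (fun N : ℕ => (tensorRank (kroneckerPow T N) : ℝ) ^ (1 / (N : ℝ))) atTop (𝓝 ρ)

/-- `T` has exponent `ω`: its asymptotic rank exists and has base-`2` logarithm `ω`. -/
def HasExponent {V : Type} [Fintype V] {ι : V → Type} (T : CoordTensor ι) (ω : EReal) : Prop :=
  ∃ ρ : ℝ, HasAsymptoticRank T ρ ∧ ω = logTwo ρ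

/-- Exponent for real weights `w e ≥ 0`: as the `N`-th Kronecker power of a graph tensor is the
graph tensor with weights `w e ^ N`, these numbers are used, rounded up, as the weights of the
`N`-th power. For natural numbers `w e` this is the exponent of the graph tensor itself. -/
def HasRealWeightExponent {V E : Type} [Fintype V] [DecidableEq V] [Fintype E]
    (inc : E → Finset V) (w : E → ℝ) (ω : EReal) : Prop :=
  ∃ ρ : ℝ, Tendsto
    (fun N : ℕ => (tensorRank (graphTensor inc (fun e => ⌈w e ^ N⌉₊)) : ℝ) ^ (1 / (N : ℝ)))
    atTop (𝓝 ρ) ∧ ω = logTwo ρ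

/-- The edges of the graph on the vertices `0, …, d`: the vertex `d` is the centre, joined to each
of the vertices `0, …, d - 1`, and there is one more edge between the vertices `0` and `1`. -/
def multiEMaMuEdge (d : ℕ) : Option (Fin d) → Finset (Fin (d + 1))
  | some i => {i.castSucc, Fin.last d}
  | none => {0, 1}

/-- Weight `a` on the edges at the centre, weight `b` on the edge between `0` and `1`. -/
def multiEMaMuWeight {R : Type} (d : ℕ) (a b : R) : Option (Fin d) → R
  | some _ => a
  | none => b

/-- The multi-extended matrix multiplication tensor `multiEMaMu(d; n, M)`. -/
def multiEMaMu (d n M : ℕ) :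
    CoordTensor (fun v => ∀ e, Fin (if v ∈ multiEMaMuEdge d e then multiEMaMuWeight d n M e else 1)) :=
  graphTensor (multiEMaMuEdge d) (multiEMaMuWeight d n M)

/-- Binary entropy, in bits. -/
noncomputable def entropyTwo (p : ℝ) : ℝ := -p * Real.logb 2 p - (1 - p) * Real.logb 2 (1 - p)

/-- The number `(1/p) [log₂(n^d + 2 n^(d-1) + n² (n+1)^(d-3) + 1) - h(p)]`, for `d ≥ 3`. -/
noncomputable def multiEMaMuBound (d n : ℕ) (p : ℝ) : ℝ :=
  1 / p * (Real.logb 2 ((n : ℝ) ^ d + 2 * (n : ℝ) ^ (d - 1)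
    + (n : ℝ) ^ 2 * ((n : ℝ) + 1) ^ (d - 3) + 1) - entropyTwo p)

/-! Only the triangle on `0`, `1`, `d` needs a nontrivial bound; every other edge is paid for by its
weight. The triangle is treated by Schönhage's method.

With X, Y, Z the variables of the second kind, `schoenhage` is Σ x_i y_j z_ij + (Σ X_ij Y_ij) Z plus
error terms, and it has rank at most (n+1)². Every error term carries some z_ij, so Z meets only X
and Y. In the (k+q)-th power, keep the indices with exactly k positions of the first kind. Wherever
the third index is Z the other two are of the second kind, so their k-sets lie in that of the third
and, having equal size, coincide with it. The errors vanish, without any passage to border rank, and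
C(k+q, k) disjoint triangles remain (`triRankLE_copies_triangle`).

If s copies of T have rank at most cs, then s copies of the t-th power have rank at most c^t s
(`TriRankLE.copies_kronecker`, `TriRankLE.triangle_pow`), so each triangle costs about
(n+1)^(2(k+q)) / C(k+q, k).

Put y = (1-p)/p, q = ⌊yk⌋. The d-2 other edges and the unused part of the edge `{0, 1}` multiply the
rank by their weights (`tensorRank_multiEMaMu_le`). Letting t, then k, tend to infinity and using
1+y = 1/p gives (1/p)[log(n^(d-2)(n+1)²) - h(p)], and n^(d-2)(n+1)² is at most the number inside the
logarithm of the bound. The limits exist by Fekete's lemma. -/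

/-- The trilinear tensor `T` is a sum of `r` simple tensors. -/
def TriRankLE {X Y Z : Type} (T : X → Y → Z → ℂ) (r : ℕ) : Prop :=
  ∃ (u : Fin r → X → ℂ) (v : Fin r → Y → ℂ) (w : Fin r → Z → ℂ),
    ∀ x y z, T x y z = ∑ a, u a x * v a y * w a z

/-! ### Rank of trilinear tensors -/

namespace TriRankLE

theorem of_sum {X Y Z A : Type} [Fintype A] {T : X → Y → Z → ℂ} (u : A → X → ℂ) (v : A → Y → ℂ)
    (w : A → Z → ℂ) (h : ∀ x y z, T x y z = ∑ a, u a x * v a y * w a z) {r : ℕ}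
    (hr : Fintype.card A = r) : TriRankLE T r := by
  let e : Fin r ≃ A := (Fintype.equivFinOfCardEq hr).symm
  refine ⟨fun a => u (e a), fun a => v (e a), fun a => w (e a), fun x y z => ?_⟩
  rw [h, ← e.sum_comp]

theorem comap {X Y Z X' Y' Z' : Type} {T : X → Y → Z → ℂ} {r : ℕ} (h : TriRankLE T r)
    {T' : X' → Y' → Z' → ℂ} (f : X' → X) (g : Y' → Y) (k : Z' → Z)
    (hT : ∀ x y z, T' x y z = T (f x) (g y) (k z)) : TriRankLE T' r := by
  obtain ⟨u, v, w, h⟩ := h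
  exact ⟨fun a x => u a (f x), fun a y => v a (g y), fun a z => w a (k z),
    fun x y z => by rw [hT, h]⟩

theorem pow {X Y Z : Type} {T : X → Y → Z → ℂ} {r : ℕ} (h : TriRankLE T r) (N : ℕ) :
    TriRankLE (fun (x : Fin N → X) (y : Fin N → Y) (z : Fin N → Z) => ∏ t, T (x t) (y t) (z t))
      (r ^ N) := by
  obtain ⟨u, v, w, h⟩ := h
  refine of_sum (A := Fin N → Fin r) (fun a x => ∏ t, u (a t) (x t))
    (fun a y => ∏ t, v (a t) (y t)) (fun a z => ∏ t, w (a t) (z t)) (fun x y z => ?_) (by simp)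
  simp_rw [h, Finset.prod_univ_sum, Fintype.piFinset_univ, Finset.prod_mul_distrib]

end TriRankLE

/-! ### Direct sums of copies and Kronecker products -/

/-- The direct sum of copies of `T`, one for each element of `σ`. -/
def triCopies (σ : Type) [DecidableEq σ] {X Y Z : Type} (T : X → Y → Z → ℂ) :
    σ × X → σ × Y → σ × Z → ℂ :=
  fun x y z => if x.1 = z.1 ∧ y.1 = z.1 then T x.2 y.2 z.2 else 0

/-- The Kronecker product of two trilinear tensors. -/
def triKronecker {X Y Z X' Y' Z' : Type} (T : X → Y → Z → ℂ) (T' : X' → Y' → Z' → ℂ) :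
    X × X' → Y × Y' → Z × Z' → ℂ :=
  fun x y z => T x.1 y.1 z.1 * T' x.2 y.2 z.2

/-- If `#σ` copies of `T` have rank at most `c * #σ`, then tensoring copies of `T'` with `T`
multiplies the rank by at most `c`. -/
theorem TriRankLE.copies_kronecker {σ : Type} [DecidableEq σ] [Fintype σ] {X Y Z X' Y' Z' : Type}
    {T : X → Y → Z → ℂ} {T' : X' → Y' → Z' → ℂ} {r r' c : ℕ} (h : TriRankLE (triCopies σ T) r)
    (h' : TriRankLE (triCopies σ T') r') (hc : r ≤ c * Fintype.card σ) :
    TriRankLE (triCopies σ (triKronecker T T')) (c * r') := by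
  obtain ⟨u, v, w, h⟩ := h
  obtain ⟨u', v', w', h'⟩ := h'
  -- The `r` terms are placed in a grid with `c` rows of `#σ` cells, empty cells being zero. Each
  -- row is a restriction of the unit tensor on `σ`, whose product with `T'` is `#σ` copies of `T'`;
  -- a row thus costs `r'`.
  obtain ⟨ψ⟩ : Nonempty (Fin r ↪ Fin c × σ) :=
    Function.Embedding.nonempty_of_card_le (by simpa using hc)
  classical
  let ext {W : Type} (f : Fin r → W → ℂ) : Fin c × σ → W → ℂ :=
    fun b x => ∑ a, if ψ a = b then f a x else 0
  have hext {W : Type} (f : Fin r → W → ℂ) (a : Fin r) (x : W) : ext f (ψ a) x = f a x := by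
    simp [ext]
  have hext0 {W : Type} (f : Fin r → W → ℂ) (b) (hb : b ∉ Set.range ψ) (x : W) :
      ext f b x = 0 := by
    refine Finset.sum_eq_zero fun a _ => if_neg fun e => hb ⟨a, e⟩
  have hsum (x y z) : triCopies σ T x y z
      = ∑ e : Fin c, ∑ s : σ, ext u (e, s) x * ext v (e, s) y * ext w (e, s) z := by
    rw [h, ← Fintype.sum_prod_type' (fun e s => ext u (e, s) x * ext v (e, s) y * ext w (e, s) z)]
    simp only [Prod.mk.eta]
    refine Fintype.sum_of_injective ψ ψ.injective _ _ (fun b hb => ?_) fun a => by simp only [hext]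
    rw [hext0 u b hb, zero_mul, zero_mul]
  refine of_sum (A := Fin c × Fin r')
    (fun b x => ∑ s, ext u (b.1, s) (x.1, x.2.1) * u' b.2 (s, x.2.2))
    (fun b x => ∑ s, ext v (b.1, s) (x.1, x.2.1) * v' b.2 (s, x.2.2))
    (fun b x => ∑ s, ext w (b.1, s) (x.1, x.2.1) * w' b.2 (s, x.2.2)) ?_ (by simp)
  rintro ⟨s, x, x'⟩ ⟨t, y, y'⟩ ⟨q, z, z'⟩
  have key : triCopies σ (triKronecker T T') (s, x, x') (t, y, y') (q, z, z')
      = triCopies σ T (s, x) (t, y) (q, z) * T' x' y' z' := by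
    simp only [triCopies, triKronecker, ite_mul, zero_mul]
  have key' (s₁ s₂ s₃ : σ) : (∑ a, u' a (s₁, x') * v' a (s₂, y') * w' a (s₃, z'))
      = if s₁ = s₃ ∧ s₂ = s₃ then T' x' y' z' else 0 := (h' _ _ _).symm
  rw [key, hsum, Fintype.sum_prod_type, Finset.sum_mul]
  refine Finset.sum_congr rfl fun e _ => ?_
  simp only [Finset.sum_mul, Finset.mul_sum]
  calc _ = ∑ s₃ : σ, ∑ s₁ : σ, ∑ s₂ : σ, ext u (e, s₁) (s, x) * ext v (e, s₂) (t, y) *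
        ext w (e, s₃) (q, z) * ∑ a, u' a (s₁, x') * v' a (s₂, y') * w' a (s₃, z') := by
        refine Finset.sum_congr rfl fun s₃ _ => ?_
        simp only [key', ite_and]
        simp
    _ = _ := by
        simp only [Finset.mul_sum]
        rw [Finset.sum_congr rfl fun s₃ _ => Finset.sum_congr rfl fun s₁ _ => Finset.sum_comm]
        rw [Finset.sum_congr rfl fun s₃ _ => Finset.sum_comm, Finset.sum_comm]
        refine Finset.sum_congr rfl fun a _ => ?_
        refine Finset.sum_congr rfl fun s₃ _ => ?_
        rw [Finset.sum_comm]
        refine Finset.sum_congr rfl fun s₂ _ => Finset.sum_congr rfl fun s₁ _ => ?_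
        ring

/-! ### Powers of copies of a triangle -/

/-- The graph tensor of the triangle, with the index sets `α`, `α` and `β` on its edges. -/
def triangle (α β : Type) [DecidableEq α] [DecidableEq β] :
    α × β → α × β → α × α → ℂ :=
  fun x y z => if x.1 = z.1 ∧ y.1 = z.2 ∧ x.2 = y.2 then 1 else 0

theorem TriRankLE.triangle_of_injective {σ α β α' β' : Type} [DecidableEq α] [DecidableEq β]
    [DecidableEq α'] [DecidableEq β'] [DecidableEq σ] {r : ℕ}
    (h : TriRankLE (triCopies σ (triangle α β)) r)
    {f : α' → α} (hf : f.Injective) {g : β' → β} (hg : g.Injective) :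
    TriRankLE (triCopies σ (triangle α' β')) r :=
  h.comap (Prod.map id (Prod.map f g)) (Prod.map id (Prod.map f g)) (Prod.map id (Prod.map f f))
    fun x y z => by simp [triCopies, triangle, hf.eq_iff, hg.eq_iff]

theorem TriRankLE.triangle_mul {σ : Type} [DecidableEq σ] [Fintype σ] {a b a' b' r r' c : ℕ}
    (h : TriRankLE (triCopies σ (triangle (Fin a) (Fin b))) r)
    (h' : TriRankLE (triCopies σ (triangle (Fin a') (Fin b'))) r')
    (hc : r ≤ c * Fintype.card σ) :
    TriRankLE (triCopies σ (triangle (Fin (a * a')) (Fin (b * b')))) (c * r') := by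
  have key : TriRankLE (triCopies σ (triangle (Fin a × Fin a') (Fin b × Fin b'))) (c * r') := by
    refine (h.copies_kronecker h' hc).comap
      (fun x => (x.1, (x.2.1.1, x.2.2.1), (x.2.1.2, x.2.2.2)))
      (fun x => (x.1, (x.2.1.1, x.2.2.1), (x.2.1.2, x.2.2.2)))
      (fun x => (x.1, (x.2.1.1, x.2.2.1), (x.2.1.2, x.2.2.2))) fun x y z => ?_
    simp only [triCopies, triKronecker, triangle, Prod.ext_iff, ← ite_and, mul_ite, mul_one, mul_zero]
    congr 1
    grind
  exact key.triangle_of_injective finProdFinEquiv.symm.injective finProdFinEquiv.symm.injective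

/-- Each further factor costs only `c`; the factor `#σ` is paid once, so it disappears
asymptotically in `t`. -/
theorem TriRankLE.triangle_pow {σ : Type} [DecidableEq σ] [Fintype σ] {a b r c : ℕ}
    (h : TriRankLE (triCopies σ (triangle (Fin a) (Fin b))) r)
    (hc : r ≤ c * Fintype.card σ) (t : ℕ) :
    TriRankLE (triCopies σ (triangle (Fin (a ^ t)) (Fin (b ^ t)))) (c ^ t * Fintype.card σ) := by
  induction t with
  | zero =>
    -- The zeroth power is a scalar, so its copies form the unit tensor on `σ`.
    refine TriRankLE.of_sum (A := σ) (fun s x => if x.1 = s then 1 else 0)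
      (fun s x => if x.1 = s then 1 else 0) (fun s x => if x.1 = s then 1 else 0) ?_ (by simp)
    rintro ⟨s, x, x'⟩ ⟨t, y, y'⟩ ⟨q, z, z'⟩
    have e1 : x = z := Subsingleton.elim (α := Fin 1) _ _
    have e2 : y = z' := Subsingleton.elim (α := Fin 1) _ _
    have e3 : x' = y' := Subsingleton.elim (α := Fin 1) _ _
    simp [triCopies, triangle, e1, e2, e3, ite_and]
    grind
  | succ t ih =>
    rw [pow_succ', pow_succ', pow_succ', mul_assoc]
    exact h.triangle_mul ih hc

/-! ### Schönhage's construction -/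

/-- The degenerate direct sum behind Schönhage's construction. -/
def schoenhage (α : Type) [DecidableEq α] : α ⊕ α × α → α ⊕ α × α → Option (α × α) → ℂ
  | .inl i, .inl j, some z => if i = z.1 ∧ j = z.2 then 1 else 0
  | .inl _, .inl _, none => 0
  | .inl i, .inr y, some z => if y = z ∧ i = z.1 then 1 else 0
  | .inl _, .inr _, none => 0
  | .inr x, .inl j, some z => if x = z ∧ j = z.2 then 1 else 0
  | .inr _, .inl _, none => 0
  | .inr x, .inr y, some z => if x = z ∧ y = z then 1 else 0
  | .inr x, .inr y, none => if x = y then 1 else 0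

/-- Expand Σ (x_i + X_ij)(y_j + Y_ij)(z_ij + Z). The unwanted terms at Z are Σ x_i (Σ_j Y_ij), Σ y_j
(Σ_i X_ij) and (Σ x_i)(Σ y_j), so subtracting them takes n + n + 1 further simple tensors. -/
theorem triRankLE_schoenhage (α : Type) [DecidableEq α] [Fintype α] :
    TriRankLE (schoenhage α) ((Fintype.card α + 1) ^ 2) := by
  refine TriRankLE.of_sum (A := Option α × Option α)
    (fun a x => match a, x with
      | (some i, _), .inl i' => if i' = i then 1 else 0
      | (some i, some j), .inr x => if x = (i, j) then 1 else 0
      | (some _, none), .inr _ => 0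
      | (none, _), .inl _ => if a.2 = none then 1 else 0
      | (none, some j), .inr x => if x.2 = j then 1 else 0
      | (none, none), .inr _ => 0)
    (fun a y => match a, y with
      | (_, some j), .inl j' => if j' = j then 1 else 0
      | (some i, some j), .inr y => if y = (i, j) then 1 else 0
      | (none, some _), .inr _ => 0
      | (_, none), .inl _ => if a.1 = none then 1 else 0
      | (some i, none), .inr y => if y.1 = i then 1 else 0
      | (none, none), .inr _ => 0)
    (fun a z => match a, z with
      | (some i, some j), some z => if z = (i, j) then 1 else 0
      | (some _, some _), none => 1
      | (_, none), some _ => 0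
      | (none, _), some _ => 0
      | (_, none), none => -1
      | (none, _), none => -1) ?_ (by simp [sq])
  rintro (i | ⟨i, j⟩) (k | ⟨k, l⟩) (_ | ⟨m, o⟩) <;>
    simp [schoenhage, Fintype.sum_prod_type, Fintype.sum_option, ite_and, Finset.sum_ite_eq]
  all_goals grind

theorem prod_ite_indicator {ι : Type} [Fintype ι] (S p q : ι → Prop) [DecidablePred S]
    [DecidablePred p] [DecidablePred q] :
    (∏ t, if S t then (if p t then (1 : ℂ) else 0) else if q t then 1 else 0)
      = if (∀ t, S t → p t) ∧ ∀ t, ¬ S t → q t then 1 else 0 := by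
  have (t : ι) : (if S t then (if p t then (1 : ℂ) else 0) else if q t then 1 else 0)
      = if (S t → p t) ∧ (¬ S t → q t) then 1 else 0 := by
    by_cases h : S t <;> simp [h]
  simp only [this, Finset.prod_ite_zero, Finset.prod_const_one, Finset.mem_univ, true_implies,
    forall_and]

/-- In the `(k + q)`-th power of Schönhage's tensor, the restriction to the indices with
`k` positions of the first kind is a direct sum of triangles. -/
theorem triRankLE_copies_triangle (n k q : ℕ) :
    TriRankLE (triCopies {S : Finset (Fin (k + q)) // S.card = k}
      (triangle (Fin (n ^ k)) (Fin ((n ^ 2) ^ q)))) (((n + 1) ^ 2) ^ (k + q)) := by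
  let σ := {S : Finset (Fin (k + q)) // S.card = k}
  have eIn (S : σ) : Nonempty ({t // t ∈ S.1} ≃ Fin k) :=
    ⟨Fintype.equivFinOfCardEq (by simpa using S.2)⟩
  have eOut (S : σ) : Nonempty ({t // t ∉ S.1} ≃ Fin q) :=
    ⟨Fintype.equivFinOfCardEq (by rw [Fintype.card_subtype_compl]; simp [S.2])⟩
  let eIn (S : σ) := (eIn S).some
  let eOut (S : σ) := (eOut S).some
  have key : TriRankLE (triCopies σ (triangle (Fin k → Fin n) (Fin q → Fin n × Fin n)))
      (((n + 1) ^ 2) ^ (k + q)) := by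
    have h := (triRankLE_schoenhage (Fin n)).pow (k + q)
    rw [Fintype.card_fin] at h
    -- The set `S` records the positions of the first kind; `eIn` and `eOut` number the positions
    -- inside and outside it.
    let φ (x : σ × (Fin k → Fin n) × (Fin q → Fin n × Fin n)) (t : Fin (k + q)) :
        Fin n ⊕ Fin n × Fin n :=
      if h : t ∈ x.1.1 then .inl (x.2.1 (eIn x.1 ⟨t, h⟩)) else .inr (x.2.2 (eOut x.1 ⟨t, h⟩))
    let χ (z : σ × (Fin k → Fin n) × (Fin k → Fin n)) (t : Fin (k + q)) :
        Option (Fin n × Fin n) :=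
      if h : t ∈ z.1.1 then some (z.2.1 (eIn z.1 ⟨t, h⟩), z.2.2 (eIn z.1 ⟨t, h⟩)) else none
    refine h.comap φ φ χ ?_
    rintro ⟨S₁, x, x'⟩ ⟨S₂, y, y'⟩ ⟨S, z, z'⟩
    by_cases hS : S₁ = S ∧ S₂ = S
    · obtain ⟨rfl, rfl⟩ := hS
      have hfac (t : Fin (k + q)) :
          schoenhage (Fin n) (φ (S₂, x, x') t) (φ (S₂, y, y') t) (χ (S₂, z, z') t)
            = if t ∈ S₂.1 then (if ∀ h : t ∈ S₂.1, x (eIn S₂ ⟨t, h⟩) = z (eIn S₂ ⟨t, h⟩) ∧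
                y (eIn S₂ ⟨t, h⟩) = z' (eIn S₂ ⟨t, h⟩) then 1 else 0)
              else if ∀ h : t ∉ S₂.1, x' (eOut S₂ ⟨t, h⟩) = y' (eOut S₂ ⟨t, h⟩)
                then 1 else 0 := by
        by_cases ht : t ∈ S₂.1 <;> simp [φ, χ, ht, schoenhage]
      simp only [hfac, prod_ite_indicator]
      simp only [triCopies, triangle, and_self, if_true]
      congr 1
      simp only [eq_iff_iff, funext_iff]
      constructor
      · rintro ⟨h₁, h₂, h₃⟩
        exact ⟨fun t _ ht => ⟨h₁ _, h₂ _⟩, fun t _ ht => h₃ _⟩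
      · rintro ⟨h₁, h₂⟩
        have h₁' (a : Fin k) := h₁ ((eIn S₂).symm a) ((eIn S₂).symm a).2 ((eIn S₂).symm a).2
        have h₂' (a : Fin q) := h₂ ((eOut S₂).symm a) ((eOut S₂).symm a).2 ((eOut S₂).symm a).2
        simp only [Subtype.coe_eta, Equiv.apply_symm_apply] at h₁' h₂'
        exact ⟨fun a => (h₁' a).1, fun a => (h₁' a).2, h₂'⟩
    -- At such a position the third index is `none` and another one is `.inl`, where the tensor
    -- vanishes. It exists because inclusions between sets of size `k` are equalities.
    · have : ∃ t, t ∉ S.1 ∧ (t ∈ S₁.1 ∨ t ∈ S₂.1) := by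
        by_contra! hcon
        refine hS ⟨Subtype.ext ?_, Subtype.ext ?_⟩
        · exact Finset.eq_of_subset_of_card_le (fun t ht => by_contra fun h => (hcon t h).1 ht)
            (by rw [S.2, S₁.2])
        · exact Finset.eq_of_subset_of_card_le (fun t ht => by_contra fun h => (hcon t h).2 ht)
            (by rw [S.2, S₂.2])
      obtain ⟨t, ht, ht'⟩ := this
      rw [Finset.prod_eq_zero (Finset.mem_univ t)]
      · simp only [triCopies, if_neg hS]
      · by_cases h₁ : t ∈ S₁.1 <;> by_cases h₂ : t ∈ S₂.1 <;>
          simp [φ, χ, ht, h₁, h₂, schoenhage] at ht' ⊢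
  refine key.triangle_of_injective finFunctionFinEquiv.symm.injective
    (g := fun b => fun t => finProdFinEquiv.symm (Fin.cast (sq n) (finFunctionFinEquiv.symm b t)))
    fun b b' hb => ?_
  refine finFunctionFinEquiv.symm.injective (funext fun t => ?_)
  exact Fin.cast_injective _ (finProdFinEquiv.symm.injective (congrFun hb t))

/-- Schönhage's bound for the powers of a triangle. -/
theorem triRankLE_triangle (n k q c t : ℕ)
    (hc : ((n + 1) ^ 2) ^ (k + q) ≤ c * (k + q).choose k) :
    TriRankLE (triangle (Fin (n ^ (k * t))) (Fin (n ^ (2 * q * t))))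
      (c ^ t * (k + q).choose k) := by
  have hcard : Fintype.card {S : Finset (Fin (k + q)) // S.card = k} = (k + q).choose k := by
    simp
  have h := (triRankLE_copies_triangle n k q).triangle_pow (by rwa [hcard]) t
  rw [hcard] at h
  -- A single copy is kept at the end, by fixing its label.
  obtain ⟨S, hS⟩ : ∃ S : Finset (Fin (k + q)), S.card = k := by
    obtain ⟨S, -, hS⟩ := Finset.exists_subset_card_eq
      (s := (Finset.univ : Finset (Fin (k + q)))) (n := k) (by simp)
    exact ⟨S, hS⟩
  rw [pow_mul, pow_mul, pow_mul]
  exact h.comap (fun x => (⟨S, hS⟩, x)) (fun x => (⟨S, hS⟩, x)) (fun x => (⟨S, hS⟩, x))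
    fun x y z => by simp [triCopies]

/-! ### Tensor rank -/

section Rank

variable {V : Type} [Fintype V]

theorem tensorRank_le_card {ι : V → Type} {A : Type} [Fintype A] {T : CoordTensor ι}
    (x : A → ∀ v, ι v → ℂ) (h : T = ∑ a, simpleTensor (x a)) : tensorRank T ≤ Fintype.card A := by
  refine Nat.sInf_le ⟨fun a => x ((Fintype.equivFin A).symm a), ?_⟩
  rw [h, ← (Fintype.equivFin A).symm.sum_comp]

/-- The infimum defining the rank is attained once some decomposition exists. Expansion in basis
tensors gives one; the coefficient is absorbed at a vertex `v₀`, which is why `V` is nonempty. -/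
theorem exists_eq_sum_simpleTensor [Nonempty V] {ι : V → Type} [∀ v, Finite (ι v)]
    (T : CoordTensor ι) :
    ∃ x : Fin (tensorRank T) → ∀ v, ι v → ℂ, ∀ i, T i = ∑ a, ∏ v, x a v (i v) := by
  classical
  have : {r : ℕ | ∃ x : Fin r → ∀ v, ι v → ℂ, T = ∑ a, simpleTensor (x a)}.Nonempty := by
    have (v : V) : Fintype (ι v) := Fintype.ofFinite _
    obtain ⟨v₀⟩ := ‹Nonempty V›
    let A := ∀ v, ι v
    let x (j : A) (v : V) (k : ι v) : ℂ := (if v = v₀ then T j else 1) * if k = j v then 1 else 0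
    have hx : T = ∑ j, simpleTensor (x j) := by
      funext i
      have (j : A) : simpleTensor (x j) i = if i = j then T j else 0 := by
        simp [simpleTensor, x, Finset.prod_ite_zero, funext_iff]
      rw [Finset.sum_apply, Finset.sum_eq_single i, this, if_pos rfl]
      · exact fun j _ hj => (this j).trans (if_neg hj.symm)
      · simp
    refine ⟨Fintype.card A, fun a => x ((Fintype.equivFin A).symm a), ?_⟩
    rw [hx, ← (Fintype.equivFin A).symm.sum_comp]
  obtain ⟨x, hx⟩ := Nat.sInf_mem this
  exact ⟨x, fun i => (congrFun hx i).trans (by rw [Finset.sum_apply]; rfl)⟩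

theorem tensorRank_comap_le [Nonempty V] {ι κ : V → Type} [∀ v, Finite (ι v)] (T : CoordTensor ι)
    {T' : CoordTensor κ} (φ : ∀ v, κ v → ι v) (h : ∀ i, T' i = T fun v => φ v (i v)) :
    tensorRank T' ≤ tensorRank T := by
  obtain ⟨x, hx⟩ := exists_eq_sum_simpleTensor T
  refine Nat.sInf_le ⟨fun a v k => x a v (φ v k), ?_⟩
  funext i
  rw [h, hx]
  simp [simpleTensor]

theorem tensorRank_mul_le [Nonempty V] {ι κ : V → Type} [∀ v, Finite (ι v)] [∀ v, Finite (κ v)]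
    (T : CoordTensor ι) (T' : CoordTensor κ) :
    tensorRank (ι := fun v => ι v × κ v) (fun i => T (fun v => (i v).1) * T' (fun v => (i v).2))
      ≤ tensorRank T * tensorRank T' := by
  obtain ⟨x, hx⟩ := exists_eq_sum_simpleTensor T
  obtain ⟨x', hx'⟩ := exists_eq_sum_simpleTensor T'
  refine (tensorRank_le_card (A := Fin (tensorRank T) × Fin (tensorRank T'))
    (fun a v k => x a.1 v k.1 * x' a.2 v k.2) ?_).trans_eq (by simp)
  funext i
  rw [hx, hx']
  simp [simpleTensor, Finset.sum_mul_sum, Fintype.sum_prod_type, Finset.prod_mul_distrib]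

theorem tensorRank_pos [Nonempty V] {ι : V → Type} [∀ v, Finite (ι v)] {T : CoordTensor ι}
    (hT : T ≠ 0) : 0 < tensorRank T := by
  by_contra! h
  obtain ⟨x, hx⟩ := exists_eq_sum_simpleTensor T
  have : IsEmpty (Fin (tensorRank T)) := by rw [Nat.le_zero.1 h]; infer_instance
  exact hT (funext fun i => by rw [hx, Finset.univ_eq_empty, Finset.sum_empty]; rfl)

theorem tensorRank_eq_zero_of_isEmpty {ι : V → Type} (v : V) [IsEmpty (ι v)]
    (T : CoordTensor ι) : tensorRank T = 0 :=
  Nat.le_zero.1 <| Nat.sInf_le ⟨Fin.elim0, funext fun i => isEmptyElim (i v)⟩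

end Rank

/-! ### Graph tensors -/

section Graph

variable {V E : Type}

/-- The graph tensor with the index set `β e` on the edge `e`, where every vertex is given
(redundant) indices for all the edges. -/
noncomputable def edgeTypeTensor (inc : E → Finset V) (β : E → Type) : CoordTensor (fun _ : V => ∀ e, β e) :=
  open Classical in fun i => if ∀ e, ∀ u ∈ inc e, ∀ v ∈ inc e, i u e = i v e then 1 else 0

variable [Fintype V]

/-- Only the common value of the indices on `I` can contribute to the sum. For empty `I` the
coefficient would be `m`. -/
theorem edgeTensor_apply [DecidableEq V] {I : Finset V} (hI : I.Nonempty) (m : ℕ)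
    (i : ∀ v, Fin (if v ∈ I then m else 1)) :
    edgeTensor I m i = open Classical in
      if ∀ u ∈ I, ∀ v ∈ I, (i u : ℕ) = i v then 1 else 0 := by
  classical
  have h (j : Fin m) : simpleTensor (fun v (x : Fin (if v ∈ I then m else 1)) =>
      if v ∈ I then (if (x : ℕ) = j then (1 : ℂ) else 0) else 1) i
        = if ∀ v ∈ I, (i v : ℕ) = j then 1 else 0 := by
    have (v : V) : (if v ∈ I then (if (i v : ℕ) = j then (1 : ℂ) else 0) else 1)
        = if v ∈ I → (i v : ℕ) = j then 1 else 0 := by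
      by_cases hv : v ∈ I <;> simp [hv]
    simp only [simpleTensor, this, Finset.prod_ite_zero, Finset.prod_const_one, Finset.mem_univ,
      true_implies]
  simp only [edgeTensor, Finset.sum_apply, h]
  obtain ⟨u₀, hu₀⟩ := hI
  have hlt : (i u₀ : ℕ) < m := by simpa [hu₀] using (i u₀).2
  rw [Finset.sum_eq_single (⟨i u₀, hlt⟩ : Fin m)]
  · congr 1
    simp only [eq_iff_iff]
    exact ⟨fun h u hu v hv => (h u hu).trans (h v hv).symm, fun h u hu => h u hu u₀ hu₀⟩
  · intro j _ hj
    exact if_neg fun h => hj (Fin.ext (h u₀ hu₀).symm)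
  · simp

theorem graphTensor_apply [Fintype E] [DecidableEq V] {inc : E → Finset V} (hinc : ∀ e, (inc e).Nonempty)
    (m : E → ℕ) (i : ∀ v, ∀ e, Fin (if v ∈ inc e then m e else 1)) :
    graphTensor inc m i = open Classical in
      if ∀ e, ∀ u ∈ inc e, ∀ v ∈ inc e, (i u e : ℕ) = i v e then 1 else 0 := by
  classical
  simp only [graphTensor, kroneckerProd, edgeTensor_apply (hinc _), Finset.prod_ite_zero,
    Finset.prod_const_one, Finset.mem_univ, true_implies]

/-- The maps between the indices of a graph tensor and those of its redundant form. -/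
theorem exists_graphTensor_eq_edgeTypeTensor [Fintype E] [DecidableEq V] {inc : E → Finset V}
    (hinc : ∀ e, (inc e).Nonempty) {m : E → ℕ} (hm : ∀ e, 1 ≤ m e) :
    (∃ φ : ∀ v, (∀ e, Fin (if v ∈ inc e then m e else 1)) → ∀ e, Fin (m e),
      ∀ i, graphTensor inc m i = edgeTypeTensor inc (fun e => Fin (m e)) fun v => φ v (i v)) ∧
    ∃ φ : ∀ v, (∀ e, Fin (m e)) → ∀ e, Fin (if v ∈ inc e then m e else 1),
      ∀ i, edgeTypeTensor inc (fun e => Fin (m e)) i = graphTensor inc m fun v => φ v (i v) := by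
  constructor
  -- Off the edge the index is the only element of `Fin 1`, sent to `0`; this needs weight at least
  -- 1.
  · refine ⟨fun v i e => Fin.castLE (by split_ifs <;> simp [hm e]) (i e), fun i => ?_⟩
    simp [graphTensor_apply hinc, edgeTypeTensor, Fin.ext_iff]
  · refine ⟨fun v i e => ⟨if v ∈ inc e then i e else 0, by split_ifs <;> simp⟩, fun i => ?_⟩
    simp only [graphTensor_apply hinc, edgeTypeTensor, Fin.ext_iff]
    congr 1
    simp +contextual

theorem tensorRank_graphTensor [Fintype E] [Nonempty V] [DecidableEq V] {inc : E → Finset V}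
    (hinc : ∀ e, (inc e).Nonempty) {m : E → ℕ} (hm : ∀ e, 1 ≤ m e) :
    tensorRank (graphTensor inc m) = tensorRank (edgeTypeTensor inc fun e => Fin (m e)) := by
  obtain ⟨⟨φ, hφ⟩, ψ, hψ⟩ := exists_graphTensor_eq_edgeTypeTensor hinc hm
  exact (tensorRank_comap_le _ φ hφ).antisymm (tensorRank_comap_le _ ψ hψ)

theorem tensorRank_edgeTypeTensor_le [Nonempty V] [Finite E] {inc : E → Finset V}
    {β β' : E → Type} [∀ e, Finite (β' e)] (f : ∀ e, β e → β' e) (hf : ∀ e, (f e).Injective) :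
    tensorRank (edgeTypeTensor inc β) ≤ tensorRank (edgeTypeTensor inc β') := by
  refine tensorRank_comap_le _ (fun v i e => f e (i e)) fun i => ?_
  simp only [edgeTypeTensor]
  congr 1
  simp only [(hf _).eq_iff]

/-- One simple tensor for each labelling of all the edges: the trivial bound, used outside the
triangle. -/
theorem tensorRank_edgeTypeTensor_le_card [Nonempty V] [Fintype E] {inc : E → Finset V}
    (hinc : ∀ e, (inc e).Nonempty) {β : E → Type} [∀ e, Fintype (β e)] :
    tensorRank (edgeTypeTensor inc β) ≤ ∏ e, Fintype.card (β e) := by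
  classical
  refine (tensorRank_le_card (A := ∀ e, β e)
    (fun j v i => if ∀ e, v ∈ inc e → i e = j e then 1 else 0) ?_).trans_eq (by simp)
  funext i
  simp only [Finset.sum_apply, simpleTensor, Finset.prod_ite_zero, Finset.prod_const_one,
    Finset.mem_univ, true_implies, edgeTypeTensor]
  choose u hu using hinc
  split_ifs with h
  · rw [Finset.sum_eq_single fun e => i (u e) e]
    · exact (if_pos fun v e hv => h e v hv _ (hu e)).symm
    · exact fun j _ hj => if_neg fun h' => hj (funext fun e => (h' _ e (hu e)).symm)
    · simp
  · refine (Finset.sum_eq_zero fun j _ => if_neg fun h' => h fun e u hu v hv => ?_).symm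
    rw [h' u e hu, h' v e hv]

theorem tensorRank_edgeTypeTensor_prod_le [Nonempty V] [Finite E] {inc : E → Finset V}
    {β β' : E → Type} [∀ e, Finite (β e)] [∀ e, Finite (β' e)] :
    tensorRank (edgeTypeTensor inc fun e => β e × β' e)
      ≤ tensorRank (edgeTypeTensor inc β) * tensorRank (edgeTypeTensor inc β') := by
  refine le_trans (tensorRank_comap_le _ (fun v i => (fun e => (i e).1, fun e => (i e).2))
    fun i => ?_) (tensorRank_mul_le _ _)
  simp only [edgeTypeTensor, ← ite_and, mul_ite, mul_one, mul_zero, Prod.ext_iff]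
  congr 1
  grind

theorem tensorRank_kroneckerPow_edgeTypeTensor [Nonempty V] [Finite E] {inc : E → Finset V}
    {β : E → Type} [∀ e, Finite (β e)] (N : ℕ) :
    tensorRank (kroneckerPow (edgeTypeTensor inc β) N)
      = tensorRank (edgeTypeTensor inc fun e => Fin N → β e) := by
  have h (i : V → Fin N → ∀ e, β e) : kroneckerPow (edgeTypeTensor inc β) N i
      = edgeTypeTensor inc (fun e => Fin N → β e) fun v e t => i v t e := by
    simp only [kroneckerPow, kroneckerProd, edgeTypeTensor, Finset.prod_ite_zero,
      Finset.prod_const_one, Finset.mem_univ, true_implies]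
    congr 1
    simp only [funext_iff, eq_iff_iff, Finset.mem_univ, true_implies]
    exact ⟨fun h e u hu v hv t => h t e u hu v hv, fun h t e u hu v hv => h e u hu v hv t⟩
  exact (tensorRank_comap_le _ (fun v i e t => i t e) h).antisymm
    (tensorRank_comap_le _ (fun v i t e => i e t) fun i => (h _).symm)

theorem tensorRank_kroneckerPow_graphTensor [Nonempty V] [Fintype E] [DecidableEq V]
    {inc : E → Finset V} (hinc : ∀ e, (inc e).Nonempty) {m : E → ℕ} (hm : ∀ e, 1 ≤ m e) (N : ℕ) :
    tensorRank (kroneckerPow (graphTensor inc m) N)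
      = tensorRank (graphTensor inc fun e => m e ^ N) := by
  obtain ⟨⟨φ, hφ⟩, ψ, hψ⟩ := exists_graphTensor_eq_edgeTypeTensor hinc hm
  have h : tensorRank (kroneckerPow (graphTensor inc m) N)
      = tensorRank (kroneckerPow (edgeTypeTensor inc fun e => Fin (m e)) N) :=
    (tensorRank_comap_le _ (fun v i t => φ v (i t))
      fun i => by simp only [kroneckerPow, kroneckerProd, hφ]).antisymm
    (tensorRank_comap_le _ (fun v i t => ψ v (i t)) fun i => by simp only [kroneckerPow, kroneckerProd, hψ])
  rw [h, tensorRank_kroneckerPow_edgeTypeTensor,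
    tensorRank_graphTensor hinc fun e => Nat.one_le_pow _ _ (hm e)]
  exact (tensorRank_edgeTypeTensor_le (fun _ => finFunctionFinEquiv)
    fun _ => finFunctionFinEquiv.injective).antisymm
    (tensorRank_edgeTypeTensor_le (fun _ => finFunctionFinEquiv.symm)
    fun _ => finFunctionFinEquiv.symm.injective)

variable [Nonempty V] [Fintype E] [DecidableEq V] {inc : E → Finset V}

theorem tensorRank_graphTensor_mono (hinc : ∀ e, (inc e).Nonempty) {m m' : E → ℕ}
    (hm : ∀ e, 1 ≤ m e) (h : ∀ e, m e ≤ m' e) :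
    tensorRank (graphTensor inc m) ≤ tensorRank (graphTensor inc m') := by
  rw [tensorRank_graphTensor hinc hm, tensorRank_graphTensor hinc fun e => (hm e).trans (h e)]
  exact tensorRank_edgeTypeTensor_le (fun e => Fin.castLE (h e)) fun e => Fin.castLE_injective _

theorem tensorRank_graphTensor_mul_le (hinc : ∀ e, (inc e).Nonempty) {m m' : E → ℕ}
    (hm : ∀ e, 1 ≤ m e) (hm' : ∀ e, 1 ≤ m' e) :
    tensorRank (graphTensor inc fun e => m e * m' e)
      ≤ tensorRank (graphTensor inc m) * tensorRank (graphTensor inc m') := by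
  rw [tensorRank_graphTensor hinc hm, tensorRank_graphTensor hinc hm',
    tensorRank_graphTensor hinc fun e => Nat.mul_pos (hm e) (hm' e)]
  exact (tensorRank_edgeTypeTensor_le (fun _ => finProdFinEquiv.symm)
    fun _ => finProdFinEquiv.symm.injective).trans tensorRank_edgeTypeTensor_prod_le

theorem tensorRank_graphTensor_le_prod (hinc : ∀ e, (inc e).Nonempty) {m : E → ℕ}
    (hm : ∀ e, 1 ≤ m e) : tensorRank (graphTensor inc m) ≤ ∏ e, m e := by
  rw [tensorRank_graphTensor hinc hm]
  simpa using tensorRank_edgeTypeTensor_le_card hinc (β := fun e => Fin (m e))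

theorem one_le_tensorRank_graphTensor (hinc : ∀ e, (inc e).Nonempty) {m : E → ℕ}
    (hm : ∀ e, 1 ≤ m e) : 1 ≤ tensorRank (graphTensor inc m) := by
  rw [tensorRank_graphTensor hinc hm]
  refine tensorRank_pos fun h => ?_
  simpa [edgeTypeTensor] using congrFun h fun _ e => ⟨0, hm e⟩

end Graph

/-! ### Reduction to the triangle -/

section MultiEMaMu

theorem multiEMaMuEdge_nonempty (d : ℕ) (e : Option (Fin d)) : (multiEMaMuEdge d e).Nonempty := by
  cases e <;> simp [multiEMaMuEdge]

/-- If only the edges of the triangle on the vertices `0`, `1`, `d` have weights other than `1`,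
then the rank is at most that of the triangle. -/
theorem tensorRank_le_of_triRankLE {d a b r : ℕ} (hd : 2 ≤ d)
    (h : TriRankLE (triangle (Fin a) (Fin b)) r) {m : Option (Fin d) → ℕ} (hm : ∀ e, 1 ≤ m e)
    (ha : ∀ l, m (some l) ≤ a) (hl : ∀ l : Fin d, 2 ≤ (l : ℕ) → m (some l) = 1)
    (hb : m none ≤ b) : tensorRank (graphTensor (multiEMaMuEdge d) m) ≤ r := by
  rw [tensorRank_graphTensor (multiEMaMuEdge_nonempty d) hm]
  obtain ⟨u, v, w, h⟩ := h
  let l₀ : Fin d := ⟨0, by omega⟩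
  let l₁ : Fin d := ⟨1, by omega⟩
  let f (l : Fin d) : Fin (m (some l)) → Fin a := Fin.castLE (ha l)
  let g : Fin (m none) → Fin b := Fin.castLE hb
  have h01 : (0 : Fin (d + 1)) ≠ 1 := by
    have : NeZero d := ⟨by omega⟩
    exact Fin.zero_ne_one'
  have h0 : (0 : Fin (d + 1)) ≠ Fin.last d := by simp [Fin.ext_iff]; omega
  have v1 : ((1 : Fin (d + 1)) : ℕ) = 1 := by
    rw [Fin.val_one']; exact Nat.mod_eq_of_lt (by omega)
  have h1 : (1 : Fin (d + 1)) ≠ Fin.last d := by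
    rw [ne_eq, Fin.ext_iff, v1, Fin.val_last]; omega
  -- The vertices outside the triangle contribute the factor 1, as their edges have a single index.
  refine (tensorRank_le_card (A := Fin r) (fun a x i =>
    if x = 0 then u a (f l₀ (i (some l₀)), g (i none))
    else if x = 1 then v a (f l₁ (i (some l₁)), g (i none))
    else if x = Fin.last d then w a (f l₀ (i (some l₀)), f l₁ (i (some l₁))) else 1)
    ?_).trans_eq (by simp)
  funext i
  have hprod (c : Fin r) : simpleTensor (fun (x : Fin (d + 1)) (i : ∀ e, Fin (m e)) =>
      if x = 0 then u c (f l₀ (i (some l₀)), g (i none))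
      else if x = 1 then v c (f l₁ (i (some l₁)), g (i none))
      else if x = Fin.last d then w c (f l₀ (i (some l₀)), f l₁ (i (some l₁))) else 1) i
      = u c (f l₀ (i 0 (some l₀)), g (i 0 none)) * v c (f l₁ (i 1 (some l₁)), g (i 1 none))
        * w c (f l₀ (i (Fin.last d) (some l₀)), f l₁ (i (Fin.last d) (some l₁))) := by
    rw [simpleTensor, ← Finset.prod_subset (Finset.subset_univ {0, 1, Fin.last d}),
      Finset.prod_insert (by simp [h01, h0]), Finset.prod_insert (by simp [h1]),
      Finset.prod_singleton]
    · simp [h01.symm, h0.symm, h1.symm, mul_assoc]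
    · intro x _ hx
      simp only [Finset.mem_insert, Finset.mem_singleton, not_or] at hx
      simp [hx.1, hx.2.1, hx.2.2]
  have hf (l : Fin d) : (f l).Injective := Fin.castLE_injective _
  have hg : g.Injective := Fin.castLE_injective _
  simp only [Finset.sum_apply, hprod, ← h, triangle, edgeTypeTensor, (hf _).eq_iff, hg.eq_iff]
  congr 1
  have c0 : l₀.castSucc = 0 := by simp [l₀]
  have c1 : l₁.castSucc = 1 := by rw [Fin.ext_iff, v1]; rfl
  rw [eq_iff_iff]
  constructor
  · intro h
    exact ⟨h (some l₀) _ (by simp [multiEMaMuEdge, c0]) _ (by simp [multiEMaMuEdge]),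
      h (some l₁) _ (by simp [multiEMaMuEdge, c1]) _ (by simp [multiEMaMuEdge]),
      h none _ (by simp [multiEMaMuEdge]) _ (by simp [multiEMaMuEdge])⟩
  · rintro ⟨e0, e1, e2⟩ (_ | l) x hx y hy
    · simp only [multiEMaMuEdge, Finset.mem_insert, Finset.mem_singleton] at hx hy
      rcases hx with rfl | rfl <;> rcases hy with rfl | rfl <;> first | rfl | simp [e2]
    · by_cases hl2 : 2 ≤ (l : ℕ)
      · have : Subsingleton (Fin (m (some l))) := by rw [hl l hl2]; infer_instance
        exact Subsingleton.elim _ _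
      · have : l = l₀ ∨ l = l₁ := by simp only [Fin.ext_iff, l₀, l₁]; omega
        simp only [multiEMaMuEdge, Finset.mem_insert, Finset.mem_singleton] at hx hy
        rcases this with rfl | rfl
        · rw [c0] at hx hy
          rcases hx with rfl | rfl <;> rcases hy with rfl | rfl <;> first | rfl | simp [e0]
        · rw [c1] at hx hy
          rcases hx with rfl | rfl <;> rcases hy with rfl | rfl <;> first | rfl | simp [e1]

/-- The rank of the tensor `multiEMaMu(d; a, b)` in terms of that of a triangle. -/
theorem tensorRank_multiEMaMu_le {d a b b' c r : ℕ} (hd : 2 ≤ d) (ha : 1 ≤ a) (hb : 1 ≤ b)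
    (hb' : 1 ≤ b') (hbc : b ≤ b' * c) (h : TriRankLE (triangle (Fin a) (Fin b')) r) :
    tensorRank (graphTensor (multiEMaMuEdge d) (multiEMaMuWeight d a b))
      ≤ r * (c * a ^ (d - 2)) := by
  have hc : 1 ≤ c := Nat.one_le_iff_ne_zero.2 (by rintro rfl; omega)
  have hne := multiEMaMuEdge_nonempty d
  -- `m₁` is the triangle; `m₂` holds the other `d - 2` edges and the excess `c` on `{0, 1}`.
  let m₁ : Option (Fin d) → ℕ := fun e => e.elim b' fun l => if (l : ℕ) < 2 then a else 1
  let m₂ : Option (Fin d) → ℕ := fun e => e.elim c fun l => if (l : ℕ) < 2 then 1 else a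
  have hm₁ (e) : 1 ≤ m₁ e := by
    cases e
    · exact hb'
    · simp only [m₁, Option.elim]; split_ifs <;> omega
  have hm₂ (e) : 1 ≤ m₂ e := by
    cases e
    · exact hc
    · simp only [m₂, Option.elim]; split_ifs <;> omega
  have hm (e) : multiEMaMuWeight d a b e ≤ m₁ e * m₂ e := by
    cases e
    · exact hbc
    · simp only [m₁, m₂, Option.elim, multiEMaMuWeight]; split_ifs <;> simp
  have hw (e) : 1 ≤ multiEMaMuWeight d a b e := by cases e <;> simpa [multiEMaMuWeight]
  have h₂ : ∏ e, m₂ e = c * a ^ (d - 2) := by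
    obtain ⟨k, rfl⟩ := Nat.exists_eq_add_of_le' hd
    simp [Fintype.prod_option, m₂, Fin.prod_univ_succ]
  refine (tensorRank_graphTensor_mono hne hw hm).trans
    ((tensorRank_graphTensor_mul_le hne hm₁ hm₂).trans (Nat.mul_le_mul ?_ ?_))
  · refine tensorRank_le_of_triRankLE hd h hm₁ (fun l => ?_) (fun l hl => if_neg (by omega)) le_rfl
    simp only [m₁, Option.elim]; split_ifs <;> omega
  · exact (tensorRank_graphTensor_le_prod hne hm₂).trans_eq h₂

end MultiEMaMu

/-! ### A lower bound for binomial coefficients -/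

section Choose

/-- The ratio of the terms `i + 1` and `i` is k(q-i) / (q(k+i+1)), at most 1. -/
theorem pow_mul_pow_mul_choose_add_le (k q i : ℕ) (hi : i ≤ q) :
    k ^ (k + i) * q ^ (q - i) * (k + q).choose (k + i) ≤ k ^ k * q ^ q * (k + q).choose k := by
  induction i with
  | zero => simp
  | succ i ih =>
    refine le_trans ?_ (ih (by omega))
    have h := Nat.choose_succ_right_eq (k + q) (k + i)
    refine Nat.le_of_mul_le_mul_right ?_ (Nat.succ_pos (k + i))
    have e : q - i = q - (i + 1) + 1 := by omega
    calc k ^ (k + (i + 1)) * q ^ (q - (i + 1)) * (k + q).choose (k + (i + 1)) * (k + i + 1)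
        = k ^ (k + i) * q ^ (q - (i + 1)) * (k * ((k + q).choose (k + i + 1) * (k + i + 1))) := by
          rw [← add_assoc, pow_succ]; ring
      _ = k ^ (k + i) * q ^ (q - (i + 1)) * (k + q).choose (k + i) * (k * (q - i)) := by
          rw [h, Nat.add_sub_add_left]; ring
      _ ≤ k ^ (k + i) * q ^ (q - (i + 1)) * (k + q).choose (k + i) * ((k + i + 1) * q) := by
          gcongr <;> omega
      _ = _ := by rw [e, pow_succ, Nat.succ_eq_add_one]; ring

/-- The largest term of the binomial expansion of `(k + q) ^ (k + q)`. -/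
theorem pow_self_le_choose (k q : ℕ) :
    (k + q) ^ (k + q) ≤ (k + q + 1) * (k ^ k * q ^ q * (k + q).choose k) := by
  rw [add_pow]
  refine (Finset.sum_le_card_nsmul _ _ (k ^ k * q ^ q * (k + q).choose k)
    fun j hj => ?_).trans_eq (by simp)
  rw [Finset.mem_range] at hj
  rcases le_total k j with h | h
  · obtain ⟨i, rfl⟩ := Nat.exists_eq_add_of_le h
    rw [Nat.add_sub_add_left]
    exact pow_mul_pow_mul_choose_add_le k q i (by omega)
  · obtain ⟨i, rfl⟩ := Nat.exists_eq_add_of_le h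
    -- Terms before the `k`-th: the same bound with `k` and `q` exchanged.
    have := pow_mul_pow_mul_choose_add_le q (j + i) i (by omega)
    have e₁ : j + i + q - j = q + i := by omega
    have e₂ : (q + (j + i)).choose (q + i) = (j + i + q).choose j := by
      rw [← Nat.choose_symm_of_eq_add (by omega : q + (j + i) = j + (q + i))]; congr 1; omega
    have e₃ : (q + (j + i)).choose q = (j + i + q).choose (j + i) := by
      rw [← Nat.choose_symm_of_eq_add (by omega : q + (j + i) = (j + i) + q)]; congr 1; omega
    rw [e₂, e₃, Nat.add_sub_cancel] at this
    rw [e₁]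
    linarith

theorem mul_log_le_log_choose {k q : ℕ} (hk : 1 ≤ k) :
    k * ((1 + q / k : ℝ) * Real.log (1 + q / k) - q / k * Real.log (q / k))
      - Real.log (k + q + 1) ≤ Real.log ((k + q).choose k) := by
  have hk0 : (0 : ℝ) < k := by exact_mod_cast hk
  have hC : (0 : ℝ) < (k + q).choose k := by exact_mod_cast Nat.choose_pos (by omega)
  have h : ((k : ℝ) + q) ^ (k + q) ≤ (k + q + 1) * (k ^ k * q ^ q * (k + q).choose k) := by
    exact_mod_cast pow_self_le_choose k q
  have hq : (0 : ℝ) < (q : ℝ) ^ q := by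
    rcases Nat.eq_zero_or_pos q with rfl | hq
    · simp
    · positivity
  have h' := Real.log_le_log (by positivity) h
  rw [Real.log_mul (by positivity) (by positivity), Real.log_mul (by positivity) (by positivity),
    Real.log_mul (by positivity) (by positivity), Real.log_pow, Real.log_pow, Real.log_pow] at h'
  have e₁ : (1 + q / k : ℝ) = (k + q) / k := by field_simp
  rw [e₁, Real.log_div (by positivity) (by positivity)]
  rcases Nat.eq_zero_or_pos q with rfl | hq
  · simp at h' ⊢
    linarith
  · rw [Real.log_div (by positivity) (by positivity)]
    push_cast at h'
    have : k * ((k + q : ℝ) / k * (Real.log (k + q) - Real.log k)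
        - q / k * (Real.log q - Real.log k))
        = (k + q) * Real.log (k + q) - k * Real.log k - q * Real.log q := by
      field_simp; ring
    linarith

end Choose

/-! ### Existence of the limit and its estimate -/

section Asymptotics

/-- The rank of the `N`-th Kronecker power of `multiEMaMu(d; n, w)`, for real `w`. -/
noncomputable def multiEMaMuPowRank (d n : ℕ) (w : ℝ) (N : ℕ) : ℕ :=
  tensorRank (graphTensor (multiEMaMuEdge d) (multiEMaMuWeight d (n ^ N) ⌈w ^ N⌉₊))

variable {d n : ℕ} {w : ℝ}

theorem one_le_multiEMaMuWeight {a b : ℕ} (ha : 1 ≤ a) (hb : 1 ≤ b) (e : Option (Fin d)) :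
    1 ≤ multiEMaMuWeight d a b e := by
  cases e <;> simpa [multiEMaMuWeight]

theorem one_le_multiEMaMuWeight_pow (hn : 1 ≤ n) (hw : 0 < w) (N : ℕ) (e : Option (Fin d)) :
    1 ≤ multiEMaMuWeight d (n ^ N) ⌈w ^ N⌉₊ e :=
  one_le_multiEMaMuWeight (Nat.one_le_pow _ _ hn) (Nat.one_le_ceil_iff.2 (pow_pos hw N)) e

theorem one_le_multiEMaMuPowRank (hn : 1 ≤ n) (hw : 0 < w) (N : ℕ) :
    1 ≤ multiEMaMuPowRank d n w N :=
  one_le_tensorRank_graphTensor (multiEMaMuEdge_nonempty d) (one_le_multiEMaMuWeight_pow hn hw N)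

/-- Rounding up is harmless: ⌈w^(M+N)⌉ ≤ ⌈w^M⌉⌈w^N⌉. -/
theorem multiEMaMuPowRank_add_le (hn : 1 ≤ n) (hw : 0 < w) (M N : ℕ) :
    multiEMaMuPowRank d n w (M + N) ≤ multiEMaMuPowRank d n w M * multiEMaMuPowRank d n w N := by
  have hne := multiEMaMuEdge_nonempty d
  refine (tensorRank_graphTensor_mono hne (one_le_multiEMaMuWeight_pow hn hw _) fun e => ?_).trans
    (tensorRank_graphTensor_mul_le hne (one_le_multiEMaMuWeight_pow hn hw M)
      (one_le_multiEMaMuWeight_pow hn hw N))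
  cases e with
  | none =>
    simp only [multiEMaMuWeight, pow_add]
    refine Nat.ceil_le.2 ?_
    push_cast
    exact mul_le_mul (Nat.le_ceil _) (Nat.le_ceil _) (by positivity) (by positivity)
  | some l => simp [multiEMaMuWeight, pow_add]

theorem subadditive_log_multiEMaMuPowRank (hn : 1 ≤ n) (hw : 0 < w) :
    Subadditive fun N => Real.log (multiEMaMuPowRank d n w N) := by
  intro M N
  have h (N : ℕ) : (0 : ℝ) < multiEMaMuPowRank d n w N := by
    exact_mod_cast one_le_multiEMaMuPowRank hn hw N
  rw [← Real.log_mul (h M).ne' (h N).ne']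
  refine Real.log_le_log (h _) ?_
  exact_mod_cast multiEMaMuPowRank_add_le hn hw M N

theorem bddBelow_log_multiEMaMuPowRank :
    BddBelow (Set.range fun N : ℕ => Real.log (multiEMaMuPowRank d n w N) / N) :=
  ⟨0, by rintro _ ⟨N, rfl⟩; exact div_nonneg (Real.log_natCast_nonneg _) (Nat.cast_nonneg _)⟩

theorem natCeil_div_le {x y : ℝ} (hx : 0 < x) (h : x ≤ y) : (⌈y / x⌉₊ : ℝ) ≤ 2 * (y / x) := by
  have h1 : 1 ≤ y / x := (one_le_div hx).2 h
  have := Nat.ceil_lt_add_one (zero_le_one.trans h1)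
  linarith

/-- The three summands are `c ^ t`, the number of copies, and the edges outside the triangle. Each
`log 2` is the cost of a ceiling; `hq` makes the triangle's edge `{0, 1}` fit into the available
weight. -/
theorem log_multiEMaMuPowRank_le {y : ℝ} (hd : 2 ≤ d) (hn : 1 ≤ n) (k q t : ℕ)
    (hq : 2 * (q : ℝ) ≤ d * y * k) :
    Real.log (multiEMaMuPowRank d n ((n : ℝ) ^ (d * y)) (k * t)) ≤
      t * (Real.log 2 + 2 * (k + q) * Real.log (n + 1) - Real.log ((k + q).choose k))
      + Real.log ((k + q).choose k)
      + (Real.log 2 + (d * y * k - 2 * q) * t * Real.log n + (d - 2) * (k * t) * Real.log n) := by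
  have hn0 : (0 : ℝ) < n := by exact_mod_cast hn
  have hn1 : (1 : ℝ) ≤ n := by exact_mod_cast hn
  have hs : (0 : ℝ) < (k + q).choose k := by exact_mod_cast Nat.choose_pos (by omega)
  set s := (k + q).choose k with hs_def
  -- So `r / s` is at least 1 and rounding it up at most doubles it.
  have hsr : (s : ℝ) ≤ (((n : ℝ) + 1) ^ 2) ^ (k + q) := by
    have h₁ : s ≤ 2 ^ (k + q) := Nat.choose_le_two_pow _ _
    have h₂ : 2 ^ (k + q) ≤ ((n + 1) ^ 2) ^ (k + q) := Nat.pow_le_pow_left (by nlinarith) _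
    exact_mod_cast h₁.trans h₂
  set r : ℝ := (((n : ℝ) + 1) ^ 2) ^ (k + q) with hr
  have hr0 : 0 < r := by positivity
  set w : ℝ := (n : ℝ) ^ (d * y) with hw
  have hw0 : 0 < w := Real.rpow_pos_of_pos hn0 _
  set b' : ℕ := n ^ (2 * q * t) with hb'
  have hb'0 : (0 : ℝ) < b' := by rw [hb']; positivity
  have hwb : (b' : ℝ) ≤ w ^ (k * t) := by
    rw [hb', Nat.cast_pow, hw, ← Real.rpow_natCast, ← Real.rpow_natCast, ← Real.rpow_mul hn0.le]
    refine Real.rpow_le_rpow_of_exponent_le hn1 ?_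
    push_cast
    nlinarith [(Nat.cast_nonneg t : (0 : ℝ) ≤ t)]
  have hlogw : Real.log (w ^ (k * t) / b') = (d * y * k - 2 * q) * t * Real.log n := by
    rw [Real.log_div (by positivity) (by positivity), Real.log_pow, hw, Real.log_rpow hn0, hb',
      Nat.cast_pow, Real.log_pow]
    push_cast
    ring
  have hlogr : Real.log (r / s) = 2 * (k + q) * Real.log (n + 1) - Real.log s := by
    rw [Real.log_div (by positivity) (by positivity), hr, Real.log_pow, Real.log_pow]
    push_cast
    ring
  set c := ⌈r / s⌉₊ with hc
  set C := ⌈w ^ (k * t) / b'⌉₊ with hC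
  have hc0 : (0 : ℝ) < c := by exact_mod_cast Nat.ceil_pos.2 (div_pos hr0 hs)
  have hC0 : (0 : ℝ) < C := by exact_mod_cast Nat.ceil_pos.2 (div_pos (by positivity) hb'0)
  have htri := triRankLE_triangle n k q c t (by
    have : r ≤ c * s := (div_le_iff₀ hs).1 (Nat.le_ceil _)
    rw [hr] at this
    exact_mod_cast this)
  have hbC : ⌈w ^ (k * t)⌉₊ ≤ b' * C := by
    refine Nat.ceil_le.2 ?_
    rw [Nat.cast_mul, mul_comm (b' : ℝ)]
    exact (div_le_iff₀ hb'0).1 (Nat.le_ceil _)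
  have hrank : multiEMaMuPowRank d n w (k * t) ≤ c ^ t * s * (C * (n ^ (k * t)) ^ (d - 2)) :=
    tensorRank_multiEMaMu_le hd (Nat.one_le_pow _ _ hn)
      (Nat.one_le_ceil_iff.2 (pow_pos hw0 _)) (Nat.one_le_pow _ _ hn) hbC htri
  have hrank' : (multiEMaMuPowRank d n w (k * t) : ℝ)
      ≤ (c : ℝ) ^ t * s * (C * ((n : ℝ) ^ (k * t)) ^ (d - 2)) := by exact_mod_cast hrank
  have hlogc : Real.log c ≤ Real.log 2 + Real.log (r / s) := by
    rw [← Real.log_mul (by norm_num) (div_pos hr0 hs).ne']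
    exact Real.log_le_log hc0 (natCeil_div_le hs hsr)
  have hlogC : Real.log C ≤ Real.log 2 + Real.log (w ^ (k * t) / b') := by
    rw [← Real.log_mul (by norm_num) (by positivity)]
    exact Real.log_le_log hC0 (natCeil_div_le hb'0 hwb)
  have hpos : (0 : ℝ) < multiEMaMuPowRank d n w (k * t) := by
    exact_mod_cast one_le_multiEMaMuPowRank hn hw0 _
  refine (Real.log_le_log hpos hrank').trans ?_
  rw [Real.log_mul (by positivity) (by positivity), Real.log_mul (by positivity) (by positivity),
    Real.log_mul (by positivity) (by positivity), Real.log_pow, Real.log_pow, Real.log_pow,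
    Nat.cast_sub hd]
  have := mul_le_mul_of_nonneg_left hlogc (Nat.cast_nonneg t : (0 : ℝ) ≤ t)
  rw [hlogr] at this
  rw [hlogw] at hlogC
  push_cast
  nlinarith

theorem lim_log_multiEMaMuPowRank_le {y : ℝ} (hd : 2 ≤ d) (hn : 1 ≤ n) (hy : 0 ≤ y) {L : ℝ}
    (hL : ∀ N : ℕ, N ≠ 0 → L ≤ Real.log (multiEMaMuPowRank d n ((n : ℝ) ^ (d * y)) N) / N) :
    L ≤ (1 + y) * (2 * Real.log (n + 1) + (d - 2) * Real.log n)
      - ((1 + y) * Real.log (1 + y) - y * Real.log y) := by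
  let ρ (k : ℕ) : ℝ := (⌊y * k⌋₊ : ℝ) / k
  have hρ : Tendsto ρ atTop (𝓝 y) :=
    (tendsto_nat_floor_mul_div_atTop hy).comp tendsto_natCast_atTop_atTop
  have hd' : (2 : ℝ) ≤ d := by exact_mod_cast hd
  have step (k : ℕ) (hk : 1 ≤ k) : L ≤ (Real.log 2 + Real.log (y + 2) + Real.log k) / k
      + 2 * (1 + ρ k) * Real.log (n + 1)
      - ((1 + ρ k) * Real.log (1 + ρ k) - ρ k * Real.log (ρ k))
      + (d * y - 2 * ρ k) * Real.log n + (d - 2) * Real.log n := by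
    set q := ⌊y * k⌋₊ with hq
    have hk0 : (0 : ℝ) < k := by exact_mod_cast hk
    have hk1 : (1 : ℝ) ≤ k := by exact_mod_cast hk
    have hqy : (q : ℝ) ≤ y * k := Nat.floor_le (by positivity)
    have hρk : ρ k = q / k := rfl
    -- Here `t` tends to infinity with `k` fixed, which removes the number of copies and one `log
    -- 2`.
    have hlim : L ≤ (Real.log 2 + 2 * (k + q) * Real.log (n + 1)
        - Real.log ((k + q).choose k)) / k
        + (d * y - 2 * ρ k) * Real.log n + (d - 2) * Real.log n := by
      set X := (Real.log 2 + 2 * (k + q) * Real.log (n + 1) - Real.log ((k + q).choose k)) / k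
        + (d * y - 2 * ρ k) * Real.log n + (d - 2) * Real.log n with hX
      set D := (Real.log ((k + q).choose k) + Real.log 2) / k with hD
      have ht : Tendsto (fun t : ℕ => X + D / t) atTop (𝓝 (X + 0)) :=
        tendsto_const_nhds.add (tendsto_const_div_atTop_nhds_zero_nat D)
      rw [add_zero] at ht
      refine ge_of_tendsto ht (eventually_atTop.2 ⟨1, fun t ht => ?_⟩)
      have ht0 : (0 : ℝ) < t := by exact_mod_cast ht
      refine (hL (k * t) (by positivity)).trans ?_
      rw [Nat.cast_mul, div_le_iff₀ (by positivity)]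
      refine (log_multiEMaMuPowRank_le hd hn k q t (by nlinarith)).trans_eq ?_
      rw [hX, hD, hρk]
      field_simp
      ring
    refine hlim.trans ?_
    have hch := mul_log_le_log_choose (q := q) hk
    have hlog : Real.log (k + q + 1) ≤ Real.log (y + 2) + Real.log k := by
      rw [← Real.log_mul (by positivity) (by positivity)]
      exact Real.log_le_log (by positivity) (by nlinarith)
    rw [← hρk] at hch
    have e : 2 * (1 + ρ k) * Real.log (n + 1) = 2 * (k + q) * Real.log (n + 1) / k := by
      rw [hρk]; field_simp
    have : (Real.log 2 + 2 * (k + q) * Real.log (n + 1) - Real.log ((k + q).choose k)) / k ≤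
        (Real.log 2 + Real.log (y + 2) + Real.log k) / k + 2 * (1 + ρ k) * Real.log (n + 1)
        - ((1 + ρ k) * Real.log (1 + ρ k) - ρ k * Real.log (ρ k)) := by
      rw [e, ← add_div, div_le_iff₀ hk0, sub_mul, div_mul_cancel₀ _ hk0.ne']
      linarith
    linarith
  have h0 : Tendsto (fun k : ℕ => (Real.log 2 + Real.log (y + 2) + Real.log k) / k) atTop
      (𝓝 0) := by
    have h₁ := tendsto_const_div_atTop_nhds_zero_nat (Real.log 2 + Real.log (y + 2))
    have h₂ : Tendsto (fun k : ℕ => Real.log k / k) atTop (𝓝 0) :=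
      Real.isLittleO_log_id_atTop.tendsto_div_nhds_zero.comp tendsto_natCast_atTop_atTop
    simpa [add_div] using h₁.add h₂
  have hlog {f : ℕ → ℝ} {a : ℝ} (hf : Tendsto f atTop (𝓝 a)) :
      Tendsto (fun k => f k * Real.log (f k)) atTop (𝓝 (a * Real.log a)) :=
    (Real.continuous_mul_log.tendsto a).comp hf
  have h1 := hρ.const_add 1
  -- Now `k` tends to infinity; continuity of x log x at 0 covers y = 0.
  have := ((((h0.add ((h1.const_mul 2).mul_const (Real.log (n + 1)))).sub
    ((hlog h1).sub (hlog hρ))).add (((hρ.const_mul 2).const_sub (d * y)).mul_const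
      (Real.log n))).add_const ((d - 2) * Real.log n))
  refine (ge_of_tendsto this (eventually_atTop.2 ⟨1, step⟩)).trans_eq ?_
  ring

/-- The left side is n^d + 2n^(d-1) + n^(d-2), and n^(d-2) ≤ n²(n+1)^(d-3). -/
theorem pow_mul_succ_sq_le (hd : 3 ≤ d) (hn : 1 ≤ n) :
    (n : ℝ) ^ (d - 2) * (n + 1) ^ 2
      ≤ n ^ d + 2 * n ^ (d - 1) + n ^ 2 * (n + 1) ^ (d - 3) + 1 := by
  obtain ⟨e, rfl⟩ := Nat.exists_eq_add_of_le' hd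
  have hn1 : (1 : ℝ) ≤ n := by exact_mod_cast hn
  have h₁ : (n : ℝ) ^ e ≤ (n + 1) ^ e := pow_le_pow_left₀ (by positivity) (by linarith) _
  have h₂ : (n : ℝ) ≤ n ^ 2 := by nlinarith
  have h₃ : (n : ℝ) * n ^ e ≤ n ^ 2 * (n + 1) ^ e := by gcongr
  have e₁ : e + 3 - 2 = e + 1 := by omega
  have e₂ : e + 3 - 1 = e + 2 := by omega
  have e₃ : e + 3 - 3 = e := by omega
  rw [e₁, e₂, e₃]
  have : (n : ℝ) ^ (e + 1) * (n + 1) ^ 2 = n ^ (e + 3) + 2 * n ^ (e + 2) + n * n ^ e := by ring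
  linarith

theorem le_multiEMaMuBound (hd : 3 ≤ d) (hn : 1 ≤ n) {p : ℝ} (hp0 : 0 < p) (hp1 : p < 1) :
    (1 + (1 - p) / p) * (2 * Real.log (n + 1) + (d - 2) * Real.log n)
      - ((1 + (1 - p) / p) * Real.log (1 + (1 - p) / p) - (1 - p) / p * Real.log ((1 - p) / p))
      ≤ multiEMaMuBound d n p * Real.log 2 := by
  have hn0 : (0 : ℝ) < n := by exact_mod_cast hn
  have e₁ : 1 + (1 - p) / p = 1 / p := by field_simp; ring
  have hlog2 : Real.log 2 ≠ 0 := (Real.log_pos (by norm_num)).ne'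
  rw [e₁, Real.log_div (sub_pos.2 hp1).ne' hp0.ne', Real.log_div one_ne_zero hp0.ne', Real.log_one,
    multiEMaMuBound, entropyTwo]
  have h := Real.log_le_log (by positivity) (pow_mul_succ_sq_le hd hn)
  rw [Real.log_mul (by positivity) (by positivity), Real.log_pow, Real.log_pow,
    Nat.cast_sub (by omega)] at h
  push_cast at h
  simp only [Real.logb]
  set Q := Real.log ((n : ℝ) ^ d + 2 * n ^ (d - 1) + n ^ 2 * (n + 1) ^ (d - 3) + 1)
  have h' := mul_le_mul_of_nonneg_left h (one_div_pos.2 hp0).le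
  have e₂ : 1 / p * (Q / Real.log 2 - (-p * (Real.log p / Real.log 2)
      - (1 - p) * (Real.log (1 - p) / Real.log 2))) * Real.log 2
      = 1 / p * Q + Real.log p + (1 - p) / p * Real.log (1 - p) := by
    field_simp
    ring
  rw [e₂]
  have e₃ : (1 / p * (0 - Real.log p) - (1 - p) / p * (Real.log (1 - p) - Real.log p))
      = - Real.log p - (1 - p) / p * Real.log (1 - p) := by
    field_simp
    ring
  rw [e₃]
  linarith

/-- The limit defining the exponent exists and is at most the bound. -/
theorem exists_tendsto_multiEMaMuPowRank (hd : 3 ≤ d) (hn : 1 ≤ n) {p : ℝ} (hp0 : 0 < p)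
    (hp1 : p < 1) : ∃ L : ℝ, L ≤ multiEMaMuBound d n p * Real.log 2 ∧
      Tendsto (fun N : ℕ => (multiEMaMuPowRank d n ((n : ℝ) ^ ((d : ℝ) * ((1 - p) / p))) N : ℝ)
        ^ (1 / (N : ℝ))) atTop (𝓝 (Real.exp L)) := by
  have hw : (0 : ℝ) < (n : ℝ) ^ ((d : ℝ) * ((1 - p) / p)) :=
    Real.rpow_pos_of_pos (by exact_mod_cast hn) _
  have hsub := subadditive_log_multiEMaMuPowRank (d := d) hn hw
  refine ⟨hsub.lim, ?_, ?_⟩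
  · refine (lim_log_multiEMaMuPowRank_le (by omega) hn (div_nonneg (sub_pos.2 hp1).le hp0.le)
      fun N hN => hsub.lim_le_div bddBelow_log_multiEMaMuPowRank hN).trans
      (le_multiEMaMuBound hd hn hp0 hp1)
  · refine ((Real.continuous_exp.tendsto _).comp
      (hsub.tendsto_lim bddBelow_log_multiEMaMuPowRank)).congr fun N => ?_
    have : (0 : ℝ) < multiEMaMuPowRank d n ((n : ℝ) ^ ((d : ℝ) * ((1 - p) / p))) N := by
      exact_mod_cast one_le_multiEMaMuPowRank hn hw N
    rw [Real.rpow_def_of_pos this, Function.comp_apply, div_eq_mul_one_div]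

theorem logTwo_exp_le {L B : ℝ} (h : L ≤ B * Real.log 2) : logTwo (Real.exp L) ≤ (B : EReal) := by
  rw [logTwo, if_neg (Real.exp_ne_zero L), Real.logb, Real.log_exp, EReal.coe_le_coe_iff]
  exact (div_le_iff₀ (Real.log_pos (by norm_num))).2 h

theorem tendsto_rpow_of_eventually_zero {f : ℕ → ℕ} (h : ∀ N, N ≠ 0 → f N = 0) :
    Tendsto (fun N : ℕ => (f N : ℝ) ^ (1 / (N : ℝ))) atTop (𝓝 0) := by
  refine tendsto_const_nhds.congr' (eventually_atTop.2 ⟨1, fun N hN => ?_⟩)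
  simp only [h N (by omega)]
  rw [Nat.cast_zero, Real.zero_rpow]
  have : (0 : ℝ) < N := by exact_mod_cast hN
  positivity

end Asymptotics

/-! ### The theorem -/

theorem isEmpty_multiEMaMu_index (d : ℕ) {m : Option (Fin d) → ℕ} (hm : m none = 0) :
    IsEmpty (∀ e, Fin (if (0 : Fin (d + 1)) ∈ multiEMaMuEdge d e then m e else 1)) :=
  ⟨fun i => by simpa [multiEMaMuEdge, hm] using (i none).pos⟩

theorem theorem4p2 (d n : ℕ) (hd : 3 ≤ d) (p : ℝ) (hp0 : 0 < p) (hp1 : p < 1) :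
    (∃ ω : EReal,
      HasRealWeightExponent (multiEMaMuEdge d)
        (multiEMaMuWeight d (n : ℝ) ((n : ℝ) ^ ((d : ℝ) * ((1 - p) / p)))) ω ∧
      ω ≤ (multiEMaMuBound d n p : EReal)) ∧
    (∀ K M : ℕ, 1 ≤ K → (M : ℝ) = ((n : ℝ) ^ ((d : ℝ) * ((1 - p) / p))) ^ K →
      ∃ ω : EReal, HasExponent (multiEMaMu d (n ^ K) M) ω ∧
        ω ≤ (((K : ℝ) * multiEMaMuBound d n p : ℝ) : EReal)) := by
  -- For n = 0 the edge `{0, 1}` has weight 0, as its exponent is positive. The ranks vanish for N ≥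
  -- 1 and the exponent is `⊥`.
  rcases Nat.eq_zero_or_pos n with rfl | hn
  · have hw : ((0 : ℕ) : ℝ) ^ ((d : ℝ) * ((1 - p) / p)) = 0 := by
      rw [Nat.cast_zero, Real.zero_rpow]
      have : (0 : ℝ) < d := by exact_mod_cast (by omega : 0 < d)
      have := div_pos (sub_pos.2 hp1) hp0
      positivity
    have hbot : logTwo 0 = ⊥ := if_pos rfl
    rw [hw]
    refine ⟨⟨_, ⟨0, tendsto_rpow_of_eventually_zero fun N hN => ?_, rfl⟩, by simp [hbot]⟩,
      fun K M hK hM => ⟨_, ⟨0, tendsto_rpow_of_eventually_zero fun N hN => ?_, rfl⟩,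
        by simp [hbot]⟩⟩
    · have := isEmpty_multiEMaMu_index d
        (m := fun e => ⌈multiEMaMuWeight d ((0 : ℕ) : ℝ) 0 e ^ N⌉₊)
        (by simp [multiEMaMuWeight, hN])
      exact tensorRank_eq_zero_of_isEmpty 0 _
    · have hM0 : M = 0 := by
        rw [zero_pow (by omega)] at hM
        exact_mod_cast hM
      have := isEmpty_multiEMaMu_index d (m := multiEMaMuWeight d (0 ^ K) M) hM0
      have : IsEmpty (Fin N → ∀ e, Fin (if (0 : Fin (d + 1)) ∈ multiEMaMuEdge d e then
          multiEMaMuWeight d (0 ^ K) M e else 1)) :=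
        ⟨fun i => isEmptyElim (i ⟨0, Nat.pos_of_ne_zero hN⟩)⟩
      exact tensorRank_eq_zero_of_isEmpty 0 _
  · obtain ⟨L, hL, hlim⟩ := exists_tendsto_multiEMaMuPowRank hd hn hp0 hp1
    refine ⟨⟨_, ⟨Real.exp L, hlim.congr fun N => ?_, rfl⟩, logTwo_exp_le hL⟩, fun K M hK hM => ?_⟩
    · have : (fun e => ⌈multiEMaMuWeight d (n : ℝ) ((n : ℝ) ^ ((d : ℝ) * ((1 - p) / p))) e ^ N⌉₊)
          = multiEMaMuWeight d (n ^ N) ⌈((n : ℝ) ^ ((d : ℝ) * ((1 - p) / p))) ^ N⌉₊ := by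
        funext e
        cases e with
        | none => rfl
        | some l => simp only [multiEMaMuWeight]; exact_mod_cast Nat.ceil_natCast (n ^ N)
      exact congrArg (fun m => (tensorRank (graphTensor (multiEMaMuEdge d) m) : ℝ) ^ (1 / (N : ℝ)))
        this.symm
    · have hw : (0 : ℝ) < (n : ℝ) ^ ((d : ℝ) * ((1 - p) / p)) :=
        Real.rpow_pos_of_pos (by exact_mod_cast hn) _
      have hM1 : 1 ≤ M := by
        have : (0 : ℝ) < M := hM ▸ pow_pos hw K
        exact_mod_cast this
      have hrank (N : ℕ) : tensorRank (kroneckerPow (multiEMaMu d (n ^ K) M) N)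
          = multiEMaMuPowRank d n ((n : ℝ) ^ ((d : ℝ) * ((1 - p) / p))) (K * N) := by
        have : (fun e => multiEMaMuWeight d (n ^ K) M e ^ N) = multiEMaMuWeight d (n ^ (K * N))
            ⌈((n : ℝ) ^ ((d : ℝ) * ((1 - p) / p))) ^ (K * N)⌉₊ := by
          funext e
          cases e with
          | none =>
            simp only [multiEMaMuWeight]
            rw [pow_mul, ← hM]
            exact_mod_cast (Nat.ceil_natCast (M ^ N)).symm
          | some l => simp only [multiEMaMuWeight, pow_mul]
        rw [multiEMaMu, tensorRank_kroneckerPow_graphTensor (multiEMaMuEdge_nonempty d)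
          (one_le_multiEMaMuWeight (Nat.one_le_pow _ _ hn) hM1)]
        exact congrArg (fun m => tensorRank (graphTensor (multiEMaMuEdge d) m)) this
      refine ⟨_, ⟨Real.exp (K * L), ?_, rfl⟩, logTwo_exp_le (by
        rw [mul_assoc]; exact mul_le_mul_of_nonneg_left hL (Nat.cast_nonneg K))⟩
      -- The `N`-th power of the `K`-th power is the term `K * N` of the first sequence, so the
      -- limit is raised to the power `K`.
      have h := (hlim.comp (tendsto_id.const_mul_atTop' (r := K) (by omega))).pow K
      rw [← Real.exp_nat_mul] at h
      refine h.congr fun N => ?_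
      rw [hrank, Function.comp_apply, id, ← Real.rpow_natCast, ← Real.rpow_mul (Nat.cast_nonneg _)]
      congr 1
      have : (K : ℝ) ≠ 0 := by exact_mod_cast (by omega : K ≠ 0)
      push_cast
      -- At N = 0 both exponents are 0, as 1 / 0 = 0.
      rcases eq_or_ne (N : ℝ) 0 with h | h
      · simp [h]
      · field_simp
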